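/- Let $T>0$, $H\in(1/2,1)$ and $a,b\in\mathbb R$ with $ab\neq0$. Write $\mathbf 1_t=\mathbf 1_{[0,t)}$ and $$c(H)=\sqrt{\frac{2H\,\Gamma(\frac32-H)}{\Gamma(H+\frac12)\,\Gamma(2-2H)}}\Bigl(H-\tfrac12\Bigr),$$ let $$K_H(t,s)=c(H)\,s^{\frac12-H}\int_s^t u^{H-\frac12}(u-s)^{H-\frac32}\,du\quad(0<s<t),\qquad K_H(t,s)=0\quad(s\ge t),$$ be the Molchan–Golosov kernel, put $L(t,s)=a\mathbf 1_t(s)+bK_H(t,s)$ and $$L^{-1}(t,s)=\frac1a\mathbf 1_t(s)+\frac1a\sum_{k=1}^\infty(-1)^k\Bigl(\frac ba\Bigr)^k\gamma_k(t,s),$$ $$\gamma_k(t,s)=\frac{c(H)^k\,\Gamma(H-\frac12)^k}{\Gamma(k(H-\frac12))}\,s^{\frac12-H}\int_s^t u^{H-\frac12}(u-s)^{k(H-\frac12)-1}\,du\quad(0<s<t),\qquad\gamma_k(t,s)=0\quad(s\ge t).$$ For a centered square-integrable process $Z=(Z_t)_{t\in[0,T]}$ let $\Lambda_Z$ be the closure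 of the linear combinations of the functions $\mathbf 1_t$, $t\in[0,T]$, under the inner product generated by $\langle\mathbf 1_t,\mathbf 1_s\rangle=\mathbb E[Z_tZ_s]$. A function $f\in L^2([0,T])$ is regarded as an element of $\Lambda_Z$ if some sequence of such step functions is Cauchy for this inner product and converges to $f$ in $L^2([0,T])$. The abstract Wiener integral $\int_0^T f\,dZ$ is the image of $f$ under the isometry $\mathbf 1_t\mapsto Z_t$ into $L^2(\Omega)$, that is, the common $L^2(\Omega)$-limit of the integrals of all such sequences; $\int_0^tf\,dZ=\int_0^Tf\mathbf 1_t\,dZ$. Let $X=aB+bB^H$ be the completely correlated mixed fractional Brownian motion on $[0,T]$ driven by a Brownian motion $B$, where $B^H_t=\int_0^tK_H(t,s)\,dB_s$. Then $X$ is an invertible Gaussian Volterra process in the following sense. 1. For all $s,t\in(0,T]$ the series defining $L^{-1}(t,s)$ converges, and for every $t\in[0,T]$ the abstract Wiener integral $$W_t=\int_0^tL^{-1}(t,s)\,dX_s$$ exists. 2. The process $W=(W_t)_{t\in[0,T]}$ is a Brownian motion: it has the finite-dimensional laws of Brownian motion, and it has a modification with almost surely continuous paths. Moreover, it is the driving Brownian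 motion: $W_t=B_t$ almost surely for every $t\in[0,T]$. 3. Conversely, $X$ is reconstructed from $W$ by the Wiener integral $$X_t=\int_0^tL(t,s)\,dW_s,\qquad t\in[0,T].$$ -/

import Mathlib

open MeasureTheory ProbabilityTheory Filter Topology

noncomputable section

namespace CCMFBM

variable {Ω : Type*} [MeasurableSpace Ω]

/-! ### Kernels -/

/-- The indicator function `𝟏_t = 𝟏_{[0,t)}`. -/
def ind (t s : ℝ) : ℝ := (Set.Ico (0 : ℝ) t).indicator (fun _ => (1 : ℝ)) s

/-- The normalizing constant `c(H)` of the Molchan–Golosov kernel. -/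
def mgConst (H : ℝ) : ℝ :=
  Real.sqrt (2 * H * Real.Gamma (3 / 2 - H) / (Real.Gamma (H + 1 / 2) * Real.Gamma (2 - 2 * H)))
    * (H - 1 / 2)

/-- The Molchan–Golosov kernel `K_H(t,s)`; it is of Volterra type, i.e. zero for `s ≥ t`. -/
def mgKernel (H t s : ℝ) : ℝ :=
  if s < t then
    mgConst H * (1 / s ^ (H - 1 / 2)) *
      ∫ u in s..t, u ^ (H - 1 / 2) / (u - s) ^ (3 / 2 - H)
  else 0

/-- The kernel `L(t,s) = a 𝟏_t(s) + b K_H(t,s)`. -/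
def kernelL (a b H t s : ℝ) : ℝ := a * ind t s + b * mgKernel H t s

/-- The functions `γ_k(t,s)`, `k ≥ 1`; zero for `s ≥ t`. -/
def gammaKernel (H : ℝ) (k : ℕ) (t s : ℝ) : ℝ :=
  if s < t then
    mgConst H ^ k * Real.Gamma (H - 1 / 2) ^ k / Real.Gamma (k * (H - 1 / 2)) *
      (1 / s ^ (H - 1 / 2)) *
      ∫ u in s..t, u ^ (H - 1 / 2) * (u - s) ^ (k * (H - 1 / 2) - 1)
  else 0

/-- The `n`-th term, which is the one with `k = n + 1 ≥ 1`, of the series in the kernel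
`L⁻¹(t,s)`. -/
def kernelLinvTerm (a b H t s : ℝ) (n : ℕ) : ℝ :=
  (-1) ^ (n + 1) * (b / a) ^ (n + 1) * gammaKernel H (n + 1) t s

/-- The kernel `L⁻¹(t,s) = a⁻¹ 𝟏_t(s) + a⁻¹ ∑_{k ≥ 1} (-1)^k (b/a)^k γ_k(t,s)`. -/
def kernelLinv (a b H t s : ℝ) : ℝ :=
  1 / a * ind t s + 1 / a * ∑' n : ℕ, kernelLinvTerm a b H t s n

/-! ### Step functions, the space `Λ`, and the abstract Wiener integral -/

/-- A finitely supported `c` encodes the formal combination `∑ c_t 𝟏_t`;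
this is the corresponding step function. -/
def stepFun (c : ℝ →₀ ℝ) (s : ℝ) : ℝ := c.sum fun t x => x * ind t s

/-- The integral `∑ c_t X_t` of the step function `∑ c_t 𝟏_t`. -/
def stepInt (X : ℝ → Ω → ℝ) (c : ℝ →₀ ℝ) (ω : Ω) : ℝ := c.sum fun t x => x * X t ω

/-- The covariance function `R(t,s) = E[X_t X_s]` of a centered process `X`. -/
def covFun (P : Measure Ω) (X : ℝ → Ω → ℝ) (t s : ℝ) : ℝ := ∫ ω, X t ω * X s ω ∂P

/-- The inner product on formal step functions generated by `⟨𝟏_t, 𝟏_s⟩_Λ = R(t,s)`. -/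
def lambdaInner (R : ℝ → ℝ → ℝ) (c d : ℝ →₀ ℝ) : ℝ :=
  c.sum fun t x => d.sum fun s y => x * y * R t s

/-- The sequence `φ` of step functions on `[0,T]` exhibits the function `f` as an element of the
closure `Λ` of the step functions for the inner product `⟨·,·⟩_Λ` of `X`: `φ` is a Cauchy sequence
for `⟨·,·⟩_Λ`, and the function that it approximates (in `L²([0,T])`) is `f`. -/
structure IsLambdaApprox (P : Measure Ω) (T : ℝ) (X : ℝ → Ω → ℝ) (f : ℝ → ℝ)
    (φ : ℕ → ℝ →₀ ℝ) : Prop where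
  support_subset : ∀ n, ((φ n).support : Set ℝ) ⊆ Set.Icc 0 T
  tendsto : Tendsto
    (fun n => eLpNorm (fun s => stepFun (φ n) s - f s) 2 (volume.restrict (Set.Icc 0 T)))
    atTop (𝓝 0)
  cauchy : Tendsto
    (fun p : ℕ × ℕ => lambdaInner (covFun P X) (φ p.1 - φ p.2) (φ p.1 - φ p.2))
    atTop (𝓝 0)

/-- `Y` is (a version of) the abstract Wiener integral `∫_0^T f(s) dX_s`, the image of `f ∈ Λ`
under the isometry `𝟏_t ↦ X_t` into `L²(Ω)`. The function `f` is required to belong to `Λ`, and `Y`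
has to be the limit for *every* sequence that exhibits `f` as an element of `Λ`, so that `Y` is
determined by `f` up to almost sure equality. -/
structure IsWienerIntegral (P : Measure Ω) (T : ℝ) (X : ℝ → Ω → ℝ) (f : ℝ → ℝ)
    (Y : Ω → ℝ) : Prop where
  memLp_integrand : MemLp f 2 (volume.restrict (Set.Icc 0 T))
  memLp_integral : MemLp Y 2 P
  exists_approx : ∃ φ, IsLambdaApprox P T X f φ
  tendsto : ∀ φ, IsLambdaApprox P T X f φ →
    Tendsto (fun n => eLpNorm (fun ω => stepInt X (φ n) ω - Y ω) 2 P) atTop (𝓝 0)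

/-- `Y` is (a version of) `∫_0^t f(s) dX_s`, i.e. of `∫_0^T f(s) 𝟏_t(s) dX_s`, where
`t ∈ [0,T]`. -/
def IsWienerIntegralUpTo (P : Measure Ω) (T : ℝ) (X : ℝ → Ω → ℝ) (t : ℝ) (f : ℝ → ℝ)
    (Y : Ω → ℝ) : Prop :=
  IsWienerIntegral P T X ((Set.Ico 0 t).indicator f) Y

/-! ### Brownian motion and the completely correlated mixed fBm on `[0,T]` -/

/-- `W` has the finite-dimensional laws of Brownian motion on `[0,T]`. -/
structure IsPreBrownianOn (P : Measure Ω) (T : ℝ) (W : ℝ → Ω → ℝ) : Prop where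
  gaussian : IsGaussianProcess (fun t : Set.Icc (0 : ℝ) T => W t) P
  mean : ∀ t ∈ Set.Icc 0 T, ∫ ω, W t ω ∂P = 0
  covariance : ∀ t ∈ Set.Icc 0 T, ∀ s ∈ Set.Icc 0 T, cov[W t, W s; P] = min t s

/-- `W` is a Brownian motion on `[0,T]`. -/
structure IsBrownianOn (P : Measure Ω) (T : ℝ) (W : ℝ → Ω → ℝ) : Prop
    extends IsPreBrownianOn P T W where
  cont : ∀ᵐ ω ∂P, ContinuousOn (fun t => W t ω) (Set.Icc 0 T)

/-- `X` is the completely correlated mixed fractional Brownian motion on `[0,T]` with parameters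
`a`, `b`, `H`, driven by `W`: `W` is a Brownian motion and `X = a W + b B^H` with
`B^H_t = ∫_0^t K_H(t,s) dW_s`. -/
structure IsCCMFBM (P : Measure Ω) (T a b H : ℝ) (W X : ℝ → Ω → ℝ) : Prop where
  brownian : IsBrownianOn P T W
  eq_mix : ∃ B : ℝ → Ω → ℝ,
    (∀ t ∈ Set.Icc 0 T, IsWienerIntegralUpTo P T W t (fun s => mgKernel H t s) (B t)) ∧
    ∀ t ∈ Set.Icc 0 T, X t =ᵐ[P] fun ω => a * W t ω + b * B t ω

end CCMFBM

end

open MeasureTheory ProbabilityTheory Filter Topology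

noncomputable section

namespace CCMFBM

variable {Ω : Type*} [MeasurableSpace Ω]

/-! ### Step functions in `L²([0,T])` -/

/-! Write α = H - 1/2, which lies in (0, 1/2), and let R be the fractional integral of order α
conjugated by the power α, with kernel s^{-α} u^α (u-s)^{α-1} / Γ(α) on 0 < s < u. The Schur test
with weight u^{-α} makes R bounded on L²([0,T]) (`exists_fracOperator`). With κ = c(H) Γ(α) one has
K_H(t,·) = κ R 𝟏_t, and the Beta integral gives the semigroup law behind γ_k(t,·) = κ^k R^k 𝟏_t.
Hence D = a + bκR sends 𝟏_t to L(t,·), and L⁻¹(t,·) is the Neumann series of D⁻¹ 𝟏_t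
(`exists_operatorL`). The factor Γ(kα+1) in the denominators of the bounds makes this series
converge for every ratio b/a, so no smallness is needed; convergence on each 𝟏_t is enough, and D is
never inverted as an operator.

On the stochastic side, let I be the Wiener isometry of B. Then X_t = I D 𝟏_t. By
`isWienerIntegral_iff`, a bounded operator J with J 𝟏_t = Z_t computes every abstract Wiener
integral against Z. So integration against X is I ∘ D, the integral of L⁻¹(t,·) is I 𝟏_t = B_t, and
therefore W = B. The reconstruction formula is X_t = I (D 𝟏_t) read with W in place of B. -/

lemma memLp_ind (T t : ℝ) : MemLp (ind t) 2 (volume.restrict (Set.Icc 0 T)) :=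
  memLp_indicator_const 2 measurableSet_Ico 1
    (Or.inr (measure_lt_top _ _).ne)

/-- The class of `𝟏_t` in `L²([0,T])`. -/
def indLp (T t : ℝ) : Lp ℝ 2 (volume.restrict (Set.Icc 0 T)) := (memLp_ind T t).toLp _

lemma coeFn_linearCombination {α : Type*} [MeasurableSpace α] {μ : Measure α}
    {v : ℝ → Lp ℝ 2 μ} {Z : ℝ → α → ℝ} {S : Set ℝ} (hZ : ∀ t ∈ S, v t =ᵐ[μ] Z t)
    (c : ℝ →₀ ℝ) (hc : (c.support : Set ℝ) ⊆ S) :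
    Finsupp.linearCombination ℝ v c =ᵐ[μ] stepInt Z c := by
  have h : ∀ A : Finset ℝ, (A : Set ℝ) ⊆ S →
      (∑ t ∈ A, c t • v t : Lp ℝ 2 μ) =ᵐ[μ] fun x => ∑ t ∈ A, c t * Z t x := by
    intro A
    induction A using Finset.induction_on with
    | empty => intro _; simpa using! Lp.coeFn_zero ℝ 2 μ
    | insert t A ht ih =>
      intro hA
      rw [Finset.coe_insert, Set.insert_subset_iff] at hA
      rw [Finset.sum_insert ht]
      filter_upwards [Lp.coeFn_add (c t • v t) (∑ t ∈ A, c t • v t), Lp.coeFn_smul (c t) (v t),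
        ih hA.2, hZ t hA.1] with x h1 h2 h3 h4
      rw [h1, Finset.sum_insert ht, Pi.add_apply, h2, h3, Pi.smul_apply, h4, smul_eq_mul]
  exact h c.support hc

lemma coeFn_linearCombination_indLp (T : ℝ) (c : ℝ →₀ ℝ) :
    Finsupp.linearCombination ℝ (indLp T) c =ᵐ[volume.restrict (Set.Icc 0 T)] stepFun c :=
  coeFn_linearCombination (S := Set.univ) (Z := ind)
    (fun t _ => (memLp_ind T t).coeFn_toLp) c (Set.subset_univ _)

lemma inner_indLp (T t : ℝ) (ht : t ∈ Set.Icc 0 T) (f : Lp ℝ 2 (volume.restrict (Set.Icc 0 T))) :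
    inner ℝ (indLp T t) f = ∫ s in (0)..t, f s := by
  rw [L2.inner_def, intervalIntegral.integral_of_le ht.1, ← integral_Ico_eq_integral_Ioc]
  have : (∫ s, inner ℝ (indLp T t s) (f s) ∂(volume.restrict (Set.Icc 0 T)))
      = ∫ s, (Set.Ico 0 t).indicator f s ∂(volume.restrict (Set.Icc 0 T)) := by
    refine integral_congr_ae ?_
    filter_upwards [(memLp_ind T t).coeFn_toLp] with s hs
    rw [indLp, hs]
    by_cases h : s ∈ Set.Ico 0 t <;> simp [ind, h]
  rw [this, integral_indicator measurableSet_Ico, Measure.restrict_restrict measurableSet_Ico,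
    Set.inter_eq_left.mpr]
  exact fun s hs => ⟨hs.1, hs.2.le.trans ht.2⟩

lemma inner_indLp_indLp (T t s : ℝ) (ht : t ∈ Set.Icc 0 T) (hs : s ∈ Set.Icc 0 T) :
    inner ℝ (indLp T t) (indLp T s) = min t s := by
  have h0 : (0 : ℝ) ≤ min t s := le_min ht.1 hs.1
  rw [L2.inner_def]
  have : (∫ x, inner ℝ (indLp T t x) (indLp T s x) ∂(volume.restrict (Set.Icc 0 T)))
      = ∫ x, (Set.Ico 0 (min t s)).indicator (fun _ => (1 : ℝ)) x
        ∂(volume.restrict (Set.Icc 0 T)) := by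
    refine integral_congr_ae ?_
    filter_upwards [(memLp_ind T t).coeFn_toLp, (memLp_ind T s).coeFn_toLp] with x h1 h2
    rw [indLp, indLp, h1, h2]
    have hm : Set.Ico 0 (min t s) = Set.Ico 0 t ∩ Set.Ico 0 s := by
      rw [Set.Ico_inter_Ico, max_self]
    by_cases h : x ∈ Set.Ico 0 t <;> by_cases h' : x ∈ Set.Ico 0 s <;>
      simp only [hm, ind, Set.indicator, Set.mem_inter_iff, h, h'] <;> simp
  rw [this, integral_indicator measurableSet_Ico, Measure.restrict_restrict measurableSet_Ico,
    Set.inter_eq_left.mpr ?_]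
  · simp [h0]
  · exact fun x hx => ⟨hx.1, hx.2.le.trans ((min_le_left _ _).trans ht.2)⟩

/-- A square-integrable function on `[0,T]` whose primitive vanishes is zero. -/
lemma eq_zero_of_forall_inner_indLp {T : ℝ} (hT : 0 < T)
    (f : Lp ℝ 2 (volume.restrict (Set.Icc 0 T)))
    (hf : ∀ t ∈ Set.Icc 0 T, inner ℝ (indLp T t) f = 0) : f = 0 := by
  have hint : IntervalIntegrable f volume 0 T := by
    rw [intervalIntegrable_iff_integrableOn_Icc_of_le hT.le]
    exact (Lp.memLp f).integrable one_le_two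
  have hd := hint.ae_hasDerivAt_integral
  rw [Lp.eq_zero_iff_ae_eq_zero]
  suffices h : ∀ᵐ x ∂(volume.restrict (Set.Ioo 0 T)), f x = 0 by
    rwa [restrict_Ioo_eq_restrict_Icc] at h
  refine (ae_restrict_iff' measurableSet_Ioo).mpr ?_
  filter_upwards [hd] with x hx hxI
  have h1 := hx (by rw [Set.uIcc_of_le hT.le]; exact ⟨hxI.1.le, hxI.2.le⟩) 0
    (by rw [Set.uIcc_of_le hT.le]; exact ⟨le_rfl, hT.le⟩)
  have h2 : (fun t => ∫ s in (0)..t, f s) =ᶠ[𝓝 x] fun _ => (0 : ℝ) := by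
    filter_upwards [Ioo_mem_nhds hxI.1 hxI.2] with t ht
    have ht' : t ∈ Set.Icc 0 T := ⟨ht.1.le, ht.2.le⟩
    rw [← inner_indLp T t ht', hf t ht']
  exact h1.unique ((hasDerivAt_const x (0 : ℝ)).congr_of_eventuallyEq h2)

/-- A vector orthogonal to every 𝟏_t has vanishing primitive, hence is zero, so the orthogonal
complement of the span is trivial. -/
lemma dense_span_indLp {T : ℝ} (hT : 0 < T) :
    Dense (Submodule.span ℝ (indLp T '' Set.Icc 0 T) :
      Set (Lp ℝ 2 (volume.restrict (Set.Icc 0 T)))) := by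
  rw [Submodule.dense_iff_topologicalClosure_eq_top, Submodule.topologicalClosure_eq_top_iff,
    Submodule.eq_bot_iff]
  intro f hf
  refine eq_zero_of_forall_inner_indLp hT f fun t ht => ?_
  exact hf _ (Submodule.subset_span ⟨t, ht, rfl⟩)

/-! ### Wiener integrals as images under continuous linear maps -/

/-- The covariance is the Gram matrix of the Z_t in L²(Ω), so the Λ-seminorm of a formal step
function is the L²(Ω)-norm of its integral. -/
lemma lambdaInner_covFun {P : Measure Ω} {T : ℝ} {Z : ℝ → Ω → ℝ}
    {v : ℝ → Lp ℝ 2 P} (hZ : ∀ t ∈ Set.Icc 0 T, v t =ᵐ[P] Z t)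
    (c : ℝ →₀ ℝ) (hc : (c.support : Set ℝ) ⊆ Set.Icc 0 T) :
    lambdaInner (covFun P Z) c c = ‖Finsupp.linearCombination ℝ v c‖ ^ 2 := by
  rw [← real_inner_self_eq_norm_sq, Finsupp.linearCombination_apply, Finsupp.sum, sum_inner]
  refine Finset.sum_congr rfl fun t ht => ?_
  rw [inner_sum]
  refine Finset.sum_congr rfl fun s hs => ?_
  have : covFun P Z t s = inner ℝ (v t) (v s) := by
    rw [L2.inner_def]
    refine integral_congr_ae ?_
    filter_upwards [hZ t (hc ht), hZ s (hc hs)] with x h1 h2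
    simp [h1, h2, mul_comm]
  simp only []
  rw [this, real_inner_smul_left, real_inner_smul_right, mul_assoc]

/-- Continuity of J decides everything: L²-convergence of step functions to f forces their integrals
to converge to J f, whichever sequence is taken, and density of the step functions supplies one such
sequence. J need not be isometric, which is what allows Z = X with J = I ∘ D. -/
theorem isWienerIntegral_iff {P : Measure Ω} {T : ℝ} (hT : 0 < T) {Z : ℝ → Ω → ℝ}
    (J : Lp ℝ 2 (volume.restrict (Set.Icc 0 T)) →L[ℝ] Lp ℝ 2 P)
    (hJ : ∀ t ∈ Set.Icc 0 T, J (indLp T t) =ᵐ[P] Z t)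
    {f : ℝ → ℝ} (u : Lp ℝ 2 (volume.restrict (Set.Icc 0 T)))
    (hu : u =ᵐ[volume.restrict (Set.Icc 0 T)] f) (Y : Ω → ℝ) :
    IsWienerIntegral P T Z f Y ↔ J u =ᵐ[P] Y := by
  set e := Finsupp.linearCombination ℝ (indLp T) with he
  have hstep : ∀ c : ℝ →₀ ℝ, (c.support : Set ℝ) ⊆ Set.Icc 0 T → J (e c) =ᵐ[P] stepInt Z c := by
    intro c hc
    have h := coeFn_linearCombination hJ c hc
    have h2 : J (e c) = Finsupp.linearCombination ℝ (fun t => J (indLp T t)) c := by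
      simp [he, Finsupp.linearCombination_apply, map_finsuppSum]
    rwa [h2]
  have hnorm : ∀ c : ℝ →₀ ℝ, (c.support : Set ℝ) ⊆ Set.Icc 0 T →
      lambdaInner (covFun P Z) c c = ‖J (e c)‖ ^ 2 := by
    intro c hc
    rw [lambdaInner_covFun hJ c hc]
    simp [he, Finsupp.linearCombination_apply, map_finsuppSum]
  have hE : ∀ c : ℝ →₀ ℝ, eLpNorm (fun s => stepFun c s - f s) 2 (volume.restrict (Set.Icc 0 T))
      = ‖e c - u‖ₑ := by
    intro c
    rw [Lp.enorm_def]
    refine eLpNorm_congr_ae ?_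
    filter_upwards [Lp.coeFn_sub (e c) u, coeFn_linearCombination_indLp T c, hu] with x h1 h2 h3
    rw [h1, Pi.sub_apply, h2, h3]
  have hF : ∀ c : ℝ →₀ ℝ, (c.support : Set ℝ) ⊆ Set.Icc 0 T → ∀ y : Lp ℝ 2 P, y =ᵐ[P] Y →
      eLpNorm (fun ω => stepInt Z c ω - Y ω) 2 P = ‖J (e c) - y‖ₑ := by
    intro c hc y hy
    rw [Lp.enorm_def]
    refine eLpNorm_congr_ae ?_
    filter_upwards [Lp.coeFn_sub (J (e c)) y, hstep c hc, hy] with x h1 h2 h3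
    rw [h1, Pi.sub_apply, h2, h3]
  have hlim : ∀ φ, IsLambdaApprox P T Z f φ →
      Tendsto (fun n => J (e (φ n))) atTop (𝓝 (J u)) := by
    intro φ hφ
    refine (J.continuous.tendsto u).comp ?_
    rw [tendsto_iff_edist_tendsto_0]
    simpa only [edist_eq_enorm_sub, ← hE] using hφ.tendsto
  constructor
  · intro h
    obtain ⟨φ, hφ⟩ := h.exists_approx
    have h1 : Tendsto (fun n => J (e (φ n))) atTop (𝓝 (h.memLp_integral.toLp Y)) := by
      rw [tendsto_iff_edist_tendsto_0]
      refine (h.tendsto φ hφ).congr fun n => ?_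
      rw [hF _ (hφ.support_subset n) _ h.memLp_integral.coeFn_toLp, edist_eq_enorm_sub]
    rw [tendsto_nhds_unique (hlim φ hφ) h1]
    exact h.memLp_integral.coeFn_toLp
  · intro h
    refine ⟨(memLp_congr_ae hu).mp (Lp.memLp u), (memLp_congr_ae h).mp (Lp.memLp (J u)), ?_, ?_⟩
    · obtain ⟨x, hx, hxu⟩ := mem_closure_iff_seq_limit.mp (dense_span_indLp hT u)
      have : ∀ n, ∃ c : ℝ →₀ ℝ, (c.support : Set ℝ) ⊆ Set.Icc 0 T ∧ e c = x n := by
        intro n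
        obtain ⟨c, hc, hcx⟩ := (Finsupp.mem_span_image_iff_linearCombination ℝ).mp (hx n)
        exact ⟨c, hc, hcx⟩
      choose φ hφ hφx using this
      refine ⟨φ, hφ, ?_, ?_⟩
      · simp only [hE, hφx, ← edist_eq_enorm_sub]
        exact tendsto_iff_edist_tendsto_0.mp hxu
      -- The Λ-distance of two steps is the distance of their images under J, and these images
      -- converge.
      · have h1 : Tendsto (fun n => J (x n)) atTop (𝓝 (J u)) := (J.continuous.tendsto u).comp hxu
        have h2 : Tendsto (fun p : ℕ × ℕ => ‖J (x p.1) - J (x p.2)‖ ^ 2) atTop (𝓝 0) := by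
          have := ((h1.comp tendsto_fst).sub (h1.comp tendsto_snd)).norm.pow 2
          rw [prod_atTop_atTop_eq] at this
          simpa using this
        refine h2.congr fun p => ?_
        rw [hnorm, map_sub, map_sub, hφx, hφx]
        classical
        refine (Finset.coe_subset.mpr Finsupp.support_sub).trans ?_
        simp [hφ]
    · intro φ hφ
      have := tendsto_iff_edist_tendsto_0.mp (hlim φ hφ)
      refine this.congr fun n => ?_
      rw [hF _ (hφ.support_subset n) _ h, edist_eq_enorm_sub]

/-! ### The Wiener isometry of a Brownian motion -/

/-- Two families of vectors with the same Gram matrix, the first of them total, are related by a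
continuous linear map. -/
lemma exists_continuousLinearMap_of_inner_eq {ι E F : Type*}
    [NormedAddCommGroup E] [InnerProductSpace ℝ E] [NormedAddCommGroup F] [InnerProductSpace ℝ F]
    [CompleteSpace F] {v : ι → E} {w : ι → F} {A : Set ι}
    (hvw : ∀ t ∈ A, ∀ s ∈ A, inner ℝ (w t) (w s) = inner ℝ (v t) (v s))
    (hv : Dense (Submodule.span ℝ (v '' A) : Set E)) :
    ∃ I : E →L[ℝ] F, ∀ t ∈ A, I (v t) = w t := by
  let e := Finsupp.linearCombination ℝ fun t : A => v t
  let g := Finsupp.linearCombination ℝ fun t : A => w t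
  have hnorm : ∀ c, ‖g c‖ = ‖e c‖ := by
    intro c
    rw [← sq_eq_sq₀ (norm_nonneg _) (norm_nonneg _), ← real_inner_self_eq_norm_sq,
      ← real_inner_self_eq_norm_sq]
    simp only [g, e, Finsupp.linearCombination_apply, Finsupp.sum, sum_inner, inner_sum]
    refine Finset.sum_congr rfl fun t _ => Finset.sum_congr rfl fun s _ => ?_
    simp only [real_inner_smul_left, real_inner_smul_right, hvw s s.2 t t.2]
  have hdense : DenseRange e := by
    have : Set.range e = (Submodule.span ℝ (v '' A) : Set E) := by
      rw [← LinearMap.coe_range, Finsupp.range_linearCombination, Set.image_eq_range]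
    rw [DenseRange, this]
    exact hv
  -- Equal norms make `g` factor through `e` with bound 1, so it extends continuously from the dense
  -- range of `e`.
  refine ⟨g.extendOfNorm e, fun t ht => ?_⟩
  have h := LinearMap.extendOfNorm_eq hdense ⟨1, fun c => by rw [hnorm c, one_mul]⟩
    (Finsupp.single ⟨t, ht⟩ (1 : ℝ))
  simpa [e, g] using h

/-- Both Gram matrices equal min(t,s): that of the 𝟏_t in L²([0,T]), and that of the centered
variables B_t in L²(Ω). -/
theorem exists_wienerIsometry {P : Measure Ω} [IsProbabilityMeasure P] {T : ℝ} (hT : 0 < T)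
    {B : ℝ → Ω → ℝ} (hB : IsPreBrownianOn P T B) :
    ∃ I : Lp ℝ 2 (volume.restrict (Set.Icc 0 T)) →L[ℝ] Lp ℝ 2 P,
      ∀ t ∈ Set.Icc 0 T, I (indLp T t) =ᵐ[P] B t := by
  classical
  have hmem : ∀ t ∈ Set.Icc 0 T, MemLp (B t) 2 P := fun t ht =>
    (hB.gaussian.hasGaussianLaw_eval ⟨t, ht⟩).memLp (by simp)
  let v : ℝ → Lp ℝ 2 P := fun t => if h : t ∈ Set.Icc 0 T then (hmem t h).toLp _ else 0
  have hv : ∀ t ∈ Set.Icc 0 T, v t =ᵐ[P] B t := fun t ht => by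
    simp only [v, dif_pos ht]
    exact (hmem t ht).coeFn_toLp
  have hinner : ∀ t ∈ Set.Icc 0 T, ∀ s ∈ Set.Icc 0 T,
      inner ℝ (v t) (v s) = inner ℝ (indLp T t) (indLp T s) := by
    intro t ht s hs
    rw [inner_indLp_indLp T t s ht hs, ← hB.covariance t ht s hs,
      covariance_eq_sub (hmem t ht) (hmem s hs), hB.mean t ht, zero_mul, sub_zero, L2.inner_def]
    refine integral_congr_ae ?_
    filter_upwards [hv t ht, hv s hs] with x h1 h2
    simp [h1, h2, mul_comm]
  obtain ⟨I, hI⟩ := exists_continuousLinearMap_of_inner_eq hinner (dense_span_indLp hT)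
  exact ⟨I, fun t ht => by rw [hI t ht]; exact hv t ht⟩

/-! ### Beta integrals and the Gamma function -/

lemma integral_rpow_mul_sub_rpow {p q a : ℝ} (hp : 0 < p) (hq : 0 < q) (ha : 0 < a) :
    ∫ x in (0)..a, x ^ (p - 1) * (a - x) ^ (q - 1)
      = a ^ (p + q - 1) * (Real.Gamma p * Real.Gamma q / Real.Gamma (p + q)) := by
  have h := Complex.betaIntegral_scaled (p : ℂ) (q : ℂ) ha
  have hb : Complex.betaIntegral p q
      = ((Real.Gamma p * Real.Gamma q / Real.Gamma (p + q) : ℝ) : ℂ) := by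
    rw [Complex.betaIntegral_eq_Gamma_mul_div p q (by simpa) (by simpa)]
    simp only [← Complex.ofReal_add, Complex.Gamma_ofReal]
    push_cast
    rfl
  have hl : ∫ x in (0)..a, (x : ℂ) ^ ((p : ℂ) - 1) * ((a : ℂ) - x) ^ ((q : ℂ) - 1)
      = ((∫ x in (0)..a, x ^ (p - 1) * (a - x) ^ (q - 1) : ℝ) : ℂ) := by
    rw [← intervalIntegral.integral_ofReal]
    refine intervalIntegral.integral_congr fun x hx => ?_
    rw [Set.uIcc_of_le ha.le] at hx
    simp only [Complex.ofReal_mul]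
    rw [Complex.ofReal_cpow hx.1, Complex.ofReal_cpow (sub_nonneg.mpr hx.2)]
    push_cast
    rfl
  have hr : (a : ℂ) ^ ((p : ℂ) + q - 1) = ((a ^ (p + q - 1) : ℝ) : ℂ) := by
    rw [Complex.ofReal_cpow ha.le]
    push_cast
    rfl
  rw [hl, hb, hr] at h
  exact_mod_cast h

lemma lintegral_sub_rpow_mul_sub_rpow {p q s v : ℝ} (hp : 0 < p) (hq : 0 < q) (hsv : s < v) :
    ∫⁻ u in Set.Ioo s v, ENNReal.ofReal ((u - s) ^ (p - 1) * (v - u) ^ (q - 1))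
      = ENNReal.ofReal ((v - s) ^ (p + q - 1)
        * (Real.Gamma p * Real.Gamma q / Real.Gamma (p + q))) := by
  have ha : 0 < v - s := sub_pos.mpr hsv
  have h : ∫ u in s..v, (u - s) ^ (p - 1) * (v - u) ^ (q - 1) = (v - s) ^ (p + q - 1)
        * (Real.Gamma p * Real.Gamma q / Real.Gamma (p + q)) := by
    rw [← integral_rpow_mul_sub_rpow hp hq ha]
    have := intervalIntegral.integral_comp_sub_right (a := s) (b := v)
      (fun x => x ^ (p - 1) * (v - s - x) ^ (q - 1)) s
    rw [sub_self] at this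
    rw [← this]
    refine intervalIntegral.integral_congr fun x _ => ?_
    simp
  have hpos : 0 < (v - s) ^ (p + q - 1)
        * (Real.Gamma p * Real.Gamma q / Real.Gamma (p + q)) := by
    have := Real.Gamma_pos_of_pos hp
    have := Real.Gamma_pos_of_pos hq
    have := Real.Gamma_pos_of_pos (add_pos hp hq)
    positivity
  rw [intervalIntegral.integral_of_le hsv.le, integral_Ioc_eq_integral_Ioo] at h
  rw [← h, ofReal_integral_eq_lintegral_ofReal]
  -- A non-integrable function would have Bochner integral 0, but the value found is positive.
  · by_contra hn
    rw [integral_undef hn] at h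
    exact hpos.ne h
  · refine (ae_restrict_iff' measurableSet_Ioo).mpr (ae_of_all _ fun u hu => ?_)
    exact mul_nonneg (Real.rpow_nonneg (sub_nonneg.mpr hu.1.le) _)
      (Real.rpow_nonneg (sub_nonneg.mpr hu.2.le) _)

lemma lintegral_sub_rpow {p s v : ℝ} (hp : 0 < p) (hsv : s < v) :
    ∫⁻ u in Set.Ioo s v, ENNReal.ofReal ((u - s) ^ (p - 1))
      = ENNReal.ofReal ((v - s) ^ p * (Real.Gamma p / Real.Gamma (p + 1))) := by
  simpa using lintegral_sub_rpow_mul_sub_rpow hp one_pos hsv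

/-- Keep only x > R in the integral for Γ(y+1), where x^y ≥ R^y. As R is free, Γ outgrows every
exponential. -/
lemma rpow_mul_exp_neg_le_Gamma {y R : ℝ} (hy : 0 ≤ y) (hR : 0 < R) :
    R ^ y * Real.exp (-R) ≤ Real.Gamma (y + 1) := by
  have hi := Real.GammaIntegral_convergent (s := y + 1) (by linarith)
  rw [Real.Gamma_eq_integral (by linarith), ← integral_exp_neg_Ioi, ← integral_const_mul]
  refine (setIntegral_mono_on (g := fun x => Real.exp (-x) * x ^ (y + 1 - 1)) ?_
    (hi.mono_set (Set.Ioi_subset_Ioi hR.le)) measurableSet_Ioi ?_).trans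
    (setIntegral_mono_set hi ?_ (Set.Ioi_subset_Ioi hR.le).eventuallyLE)
  · exact (integrableOn_exp_neg_Ioi R).const_mul _
  · intro x hx
    rw [mul_comm, add_sub_cancel_right]
    exact mul_le_mul_of_nonneg_left (Real.rpow_le_rpow hR.le (le_of_lt hx) hy) (Real.exp_nonneg _)
  · refine (ae_restrict_iff' measurableSet_Ioi).mpr (ae_of_all _ fun x hx => ?_)
    exact mul_nonneg (Real.exp_nonneg _) (Real.rpow_nonneg (le_of_lt hx) _)

/-- The Mittag-Leffler series converges. -/
lemma summable_pow_div_Gamma {α : ℝ} (hα : 0 < α) (M : ℝ) :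
    Summable fun k : ℕ => M ^ k / Real.Gamma (k * α + 1) := by
  -- With R^α = N the lower bound reads Γ(kα+1) ≥ N^k e^{-R}, and |M| ≤ N/2 leaves a geometric
  -- series of ratio 1/2.
  set N := 2 * (|M| + 1) with hN
  have hN0 : 0 < N := by positivity
  set R := N ^ α⁻¹ with hR
  have hR0 : 0 < R := Real.rpow_pos_of_pos hN0 _
  have hRα : R ^ α = N := Real.rpow_inv_rpow hN0.le hα.ne'
  have hgeo : Summable fun k : ℕ => Real.exp R * (1 / 2 : ℝ) ^ k :=
    summable_geometric_two.mul_left _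
  refine Summable.of_norm_bounded hgeo fun k => ?_
  have hk : 0 ≤ (k : ℝ) * α := by positivity
  have hG := rpow_mul_exp_neg_le_Gamma hk hR0
  have hGp : 0 < Real.Gamma (k * α + 1) := Real.Gamma_pos_of_pos (by linarith)
  rw [mul_comm (k : ℝ) α, Real.rpow_mul hR0.le, hRα, Real.rpow_natCast, mul_comm α] at hG
  rw [norm_div, norm_pow, Real.norm_eq_abs, Real.norm_of_nonneg hGp.le, div_le_iff₀ hGp]
  have h1 : |M| ≤ (1 / 2) * N := by rw [hN]; linarith
  calc |M| ^ k ≤ ((1 / 2) * N) ^ k := pow_le_pow_left₀ (abs_nonneg _) h1 k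
    _ = Real.exp R * (1 / 2) ^ k * (N ^ k * Real.exp (-R)) := by
        rw [Real.exp_neg, mul_pow]
        field_simp
    _ ≤ _ := mul_le_mul_of_nonneg_left hG (by positivity)

/-! ### Weighted fractional integration kernels -/

/-- The kernel `s^{-α} u^α (u-s)^{p-1} / Γ(p)`, `0 < s < u`, of the fractional integral of order
`p` conjugated by the power `α`. -/
def fracKernel (α p s u : ℝ) : ℝ :=
  if 0 < s ∧ s < u then (Real.Gamma p)⁻¹ * (s ^ α)⁻¹ * (u ^ α * (u - s) ^ (p - 1)) else 0

lemma fracKernel_of_lt {α p s u : ℝ} (hs : 0 < s) (hu : s < u) : fracKernel α p s u =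
    (Real.Gamma p)⁻¹ * (s ^ α)⁻¹ * (u ^ α * (u - s) ^ (p - 1)) := if_pos ⟨hs, hu⟩

lemma fracKernel_of_le {α p s u : ℝ} (hu : u ≤ s) : fracKernel α p s u = 0 :=
  if_neg fun h => h.2.not_ge hu

lemma fracKernel_nonneg {α p : ℝ} (hp : 0 < p) (s u : ℝ) : 0 ≤ fracKernel α p s u := by
  by_cases h : 0 < s ∧ s < u
  · rw [fracKernel_of_lt h.1 h.2]
    have := Real.Gamma_pos_of_pos hp
    have := h.1.trans h.2
    have := sub_pos.mpr h.2
    have := h.1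
    positivity
  · rw [fracKernel, if_neg h]

lemma measurable_fracKernel (α p : ℝ) :
    Measurable (Function.uncurry (fracKernel α p)) := by
  unfold Function.uncurry fracKernel
  refine Measurable.ite ?_ (by fun_prop) measurable_const
  exact (measurableSet_lt measurable_const measurable_fst).inter
    (measurableSet_lt measurable_fst measurable_snd)

lemma measurable_fracKernel_right (α p s : ℝ) : Measurable (fracKernel α p s) :=
  (measurable_fracKernel α p).comp measurable_prodMk_left

/-- The semigroup property of the weighted fractional integration kernels. -/
lemma lintegral_fracKernel_mul_fracKernel {α p q : ℝ} (hp : 0 < p) (hq : 0 < q) (s v : ℝ) :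
    ∫⁻ u, ENNReal.ofReal (fracKernel α p s u) * ENNReal.ofReal (fracKernel α q u v)
      = ENNReal.ofReal (fracKernel α (p + q) s v) := by
  by_cases h : 0 < s ∧ s < v
  · obtain ⟨hs, hv⟩ := h
    have hGp := Real.Gamma_pos_of_pos hp
    have hGq := Real.Gamma_pos_of_pos hq
    have hpt : ∀ u, ENNReal.ofReal (fracKernel α p s u) * ENNReal.ofReal (fracKernel α q u v)
        = (Set.Ioo s v).indicator (fun u => ENNReal.ofReal ((Real.Gamma p)⁻¹ * (Real.Gamma q)⁻¹ *
          (s ^ α)⁻¹ * v ^ α) * ENNReal.ofReal ((u - s) ^ (p - 1) * (v - u) ^ (q - 1))) u := by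
      intro u
      by_cases hu : u ∈ Set.Ioo s v
      · have hu0 : 0 < u := hs.trans hu.1
        have hv0 : 0 < v := hs.trans hv
        rw [Set.indicator_of_mem hu, ← ENNReal.ofReal_mul (fracKernel_nonneg hp _ _),
          ← ENNReal.ofReal_mul (by positivity), fracKernel_of_lt hs hu.1,
          fracKernel_of_lt hu0 hu.2]
        congr 1
        -- The weights u^α and u^{-α} at the intermediate point cancel, leaving a pure Beta
        -- integral.
        have : u ^ α ≠ 0 := (Real.rpow_pos_of_pos hu0 _).ne'
        field_simp
      · rw [Set.indicator_of_notMem hu]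
        by_cases h1 : s < u
        · rw [fracKernel_of_le (s := u) (not_lt.mp fun h2 => hu ⟨h1, h2⟩)]
          simp
        · rw [fracKernel_of_le (not_lt.mp h1)]
          simp
    simp_rw [hpt]
    have hv0 : 0 < v := hs.trans hv
    rw [lintegral_indicator measurableSet_Ioo, lintegral_const_mul' _ _ ENNReal.ofReal_ne_top,
      lintegral_sub_rpow_mul_sub_rpow hp hq hv, ← ENNReal.ofReal_mul (by positivity),
      fracKernel_of_lt hs hv]
    congr 1
    field_simp
  · have hz : ∀ u, ENNReal.ofReal (fracKernel α p s u) * ENNReal.ofReal (fracKernel α q u v)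
        = 0 := by
      intro u
      by_cases h1 : 0 < s ∧ s < u
      · have : v ≤ u := by
          by_contra! h2
          exact h ⟨h1.1, h1.2.trans h2⟩
        rw [fracKernel_of_le this]
        simp
      · rw [fracKernel, if_neg h1]
        simp
    simp_rw [hz]
    rw [lintegral_zero, fracKernel, if_neg h, ENNReal.ofReal_zero]

/-- Bound u^α by t^α and integrate (u-s)^{p-1} exactly. The singularity s^{-α} does not depend on p,
while the constant decays like 1/Γ(p+1); this is what makes the series summable. -/
lemma setLIntegral_Iio_fracKernel_le {α p t : ℝ} (hα : 0 ≤ α) (hp : 0 < p) (s : ℝ) :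
    ∫⁻ u in Set.Iio t, ENNReal.ofReal (fracKernel α p s u)
      ≤ ENNReal.ofReal (t ^ α * t ^ p / Real.Gamma (p + 1) * (s ^ α)⁻¹) := by
  by_cases h : 0 < s ∧ s < t
  · obtain ⟨hs, ht⟩ := h
    have ht0 := hs.trans ht
    have hGp := Real.Gamma_pos_of_pos hp
    have hGp1 := Real.Gamma_pos_of_pos (add_pos hp one_pos)
    have hpt : ∀ u, (Set.Iio t).indicator (fun u => ENNReal.ofReal (fracKernel α p s u)) u
        ≤ (Set.Ioo s t).indicator (fun u => ENNReal.ofReal ((Real.Gamma p)⁻¹ *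
          (s ^ α)⁻¹ * t ^ α) * ENNReal.ofReal ((u - s) ^ (p - 1))) u := by
      intro u
      by_cases hut : u < t
      · by_cases hsu : s < u
        · rw [Set.indicator_of_mem (show u ∈ Set.Iio t from hut),
            Set.indicator_of_mem (show u ∈ Set.Ioo s t from ⟨hsu, hut⟩),
            ← ENNReal.ofReal_mul (by positivity), fracKernel_of_lt hs hsu]
          refine ENNReal.ofReal_le_ofReal ?_
          have h1 : u ^ α ≤ t ^ α := Real.rpow_le_rpow (hs.trans hsu).le hut.le hα
          have h2 : 0 ≤ (u - s) ^ (p - 1) := Real.rpow_nonneg (sub_nonneg.mpr hsu.le) _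
          rw [mul_assoc ((Real.Gamma p)⁻¹ * (s ^ α)⁻¹)]
          gcongr
        · rw [Set.indicator_of_mem (show u ∈ Set.Iio t from hut),
            fracKernel_of_le (not_lt.mp hsu)]
          simp
      · rw [Set.indicator_of_notMem (show u ∉ Set.Iio t from hut)]
        exact zero_le
    rw [← lintegral_indicator measurableSet_Iio]
    refine (lintegral_mono hpt).trans ?_
    rw [lintegral_indicator measurableSet_Ioo, lintegral_const_mul' _ _ ENNReal.ofReal_ne_top,
      lintegral_sub_rpow hp ht, ← ENNReal.ofReal_mul (by positivity)]
    refine ENNReal.ofReal_le_ofReal ?_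
    have h1 : (t - s) ^ p ≤ t ^ p := Real.rpow_le_rpow (sub_nonneg.mpr ht.le) (by linarith) hp.le
    calc (Real.Gamma p)⁻¹ * (s ^ α)⁻¹ * t ^ α * ((t - s) ^ p * (Real.Gamma p / Real.Gamma (p + 1)))
        = t ^ α * (t - s) ^ p / Real.Gamma (p + 1) * (s ^ α)⁻¹ := by field_simp
      _ ≤ _ := by gcongr
  · refine (setLIntegral_congr_fun measurableSet_Iio (g := fun _ => 0) ?_).le.trans (by simp)
    intro u hu
    have : ¬ (0 < s ∧ s < u) := fun h' => h ⟨h'.1, h'.2.trans hu⟩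
    simp [fracKernel, this]

/-- The weighted fractional integral of order `p` of `𝟏_t`. -/
def fracPrim (α p t s : ℝ) : ℝ :=
  (∫⁻ u in Set.Iio t, ENNReal.ofReal (fracKernel α p s u)).toReal

/-- The integral is finite by domination, so the `toReal` in `fracPrim` loses nothing. -/
lemma ofReal_fracPrim {α p : ℝ} (hα : 0 ≤ α) (hp : 0 < p) (t s : ℝ) :
    ENNReal.ofReal (fracPrim α p t s)
      = ∫⁻ u in Set.Iio t, ENNReal.ofReal (fracKernel α p s u) :=
  ENNReal.ofReal_toReal
    ((setLIntegral_Iio_fracKernel_le hα hp s).trans_lt ENNReal.ofReal_lt_top).ne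

lemma fracPrim_nonneg (α p t s : ℝ) : 0 ≤ fracPrim α p t s := ENNReal.toReal_nonneg

lemma fracPrim_le {α p t : ℝ} (hα : 0 ≤ α) (hp : 0 < p) (ht : 0 ≤ t) {s : ℝ} (hs : 0 ≤ s) :
    fracPrim α p t s ≤ t ^ α * t ^ p / Real.Gamma (p + 1) * (s ^ α)⁻¹ := by
  refine ENNReal.toReal_le_of_le_ofReal ?_ (setLIntegral_Iio_fracKernel_le hα hp s)
  have := Real.Gamma_pos_of_pos (add_pos hp one_pos)
  positivity

lemma fracPrim_eq_zero {α p t s : ℝ} (h : ¬ (0 < s ∧ s < t)) : fracPrim α p t s = 0 := by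
  rw [fracPrim, setLIntegral_congr_fun measurableSet_Iio (g := fun _ => 0)]
  · simp
  intro u hu
  have : ¬ (0 < s ∧ s < u) := fun h' => h ⟨h'.1, h'.2.trans hu⟩
  simp [fracKernel, this]

lemma measurable_fracPrim (α p t : ℝ) : Measurable (fracPrim α p t) :=
  (Measurable.lintegral_prod_right (ν := volume.restrict (Set.Iio t))
    (measurable_fracKernel α p).ennreal_ofReal).ennreal_toReal

lemma fracPrim_eq_integral {α p t s : ℝ} (hp : 0 < p) (hs : 0 < s) (hst : s < t) :
    fracPrim α p t s
      = (Real.Gamma p)⁻¹ * (s ^ α)⁻¹ * ∫ u in s..t, u ^ α * (u - s) ^ (p - 1) := by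
  have hI : ∫ u in s..t, (Real.Gamma p)⁻¹ * (s ^ α)⁻¹ * (u ^ α * (u - s) ^ (p - 1))
      = ∫ u in Set.Iio t, fracKernel α p s u := by
    rw [intervalIntegral.integral_of_le hst.le, integral_Ioc_eq_integral_Ioo,
      ← integral_indicator measurableSet_Ioo, ← integral_indicator measurableSet_Iio]
    congr 1 with u
    by_cases hut : u < t
    · rw [Set.indicator_of_mem (show u ∈ Set.Iio t from hut)]
      by_cases hsu : s < u
      · rw [Set.indicator_of_mem (show u ∈ Set.Ioo s t from ⟨hsu, hut⟩), fracKernel_of_lt hs hsu]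
      · rw [Set.indicator_of_notMem (fun h => hsu h.1), fracKernel_of_le (not_lt.mp hsu)]
    · rw [Set.indicator_of_notMem (show u ∉ Set.Iio t from hut),
        Set.indicator_of_notMem (fun h => hut h.2)]
  rw [← intervalIntegral.integral_const_mul, hI, integral_eq_lintegral_of_nonneg_ae
    (ae_of_all _ fun u => fracKernel_nonneg hp s u)
    (measurable_fracKernel_right α p s).aestronglyMeasurable, fracPrim]

/-! ### Identification of γ_k and K_H with weighted fractional integrals of 𝟏_t. -/

lemma gammaKernel_eq {H : ℝ} (hH : 1 / 2 < H) {k : ℕ} (hk : k ≠ 0) (t : ℝ) {s : ℝ} (hs : 0 ≤ s) :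
    gammaKernel H k t s = (mgConst H * Real.Gamma (H - 1 / 2)) ^ k
      * fracPrim (H - 1 / 2) (k * (H - 1 / 2)) t s := by
  by_cases h : 0 < s ∧ s < t
  · have hp : 0 < (k : ℝ) * (H - 1 / 2) :=
      mul_pos (Nat.cast_pos.mpr (Nat.pos_of_ne_zero hk)) (sub_pos.mpr hH)
    rw [gammaKernel, if_pos h.2, fracPrim_eq_integral hp h.1 h.2, mul_pow]
    ring
  · rw [fracPrim_eq_zero h, mul_zero, gammaKernel]
    split_ifs with h1
    -- At s = 0 the prefactor is 1 / 0^α = 1 / 0 = 0, so both sides vanish.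
    · have : s = 0 := le_antisymm (not_lt.mp fun h2 => h ⟨h2, h1⟩) hs
      rw [this, Real.zero_rpow (by linarith)]
      simp
    · rfl

lemma mgKernel_eq {H : ℝ} (hH : 1 / 2 < H) (t : ℝ) {s : ℝ} (hs : 0 ≤ s) :
    mgKernel H t s = mgConst H * Real.Gamma (H - 1 / 2)
      * fracPrim (H - 1 / 2) (H - 1 / 2) t s := by
  by_cases h : 0 < s ∧ s < t
  · have hG := Real.Gamma_pos_of_pos (sub_pos.mpr hH)
    rw [mgKernel, if_pos h.2, fracPrim_eq_integral (sub_pos.mpr hH) h.1 h.2]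
    have : ∫ u in s..t, u ^ (H - 1 / 2) / (u - s) ^ (3 / 2 - H)
        = ∫ u in s..t, u ^ (H - 1 / 2) * (u - s) ^ (H - 1 / 2 - 1) := by
      refine intervalIntegral.integral_congr fun u hu => ?_
      rw [Set.uIcc_of_le h.2.le] at hu
      rw [div_eq_mul_inv, ← Real.rpow_neg (sub_nonneg.mpr hu.1)]
      congr 2
      ring
    rw [this, mul_assoc _ (Real.Gamma (H - 1 / 2)), ← mul_assoc (Real.Gamma (H - 1 / 2)),
      ← mul_assoc (Real.Gamma (H - 1 / 2)), mul_inv_cancel₀ hG.ne']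
    ring
  · rw [fracPrim_eq_zero h, mul_zero, mgKernel]
    split_ifs with h1
    · have : s = 0 := le_antisymm (not_lt.mp fun h2 => h ⟨h2, h1⟩) hs
      rw [this, Real.zero_rpow (by linarith)]
      simp
    · rfl

/-! ### The Schur test -/

-- Cauchy–Schwarz in squared form.
open scoped ENNReal in
lemma lintegral_mul_sq_le {α : Type*} [MeasurableSpace α] {μ : Measure α} {f g : α → ℝ≥0∞}
    (hf : AEMeasurable f μ) (hg : AEMeasurable g μ) :
    (∫⁻ x, f x * g x ∂μ) ^ 2 ≤ (∫⁻ x, f x ^ 2 ∂μ) * ∫⁻ x, g x ^ 2 ∂μ := by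
  have h := ENNReal.lintegral_mul_le_Lp_mul_Lq μ Real.HolderConjugate.two_two hf hg
  simp only [Pi.mul_apply, ENNReal.rpow_two] at h
  refine (pow_le_pow_left₀ zero_le h 2).trans_eq ?_
  rw [mul_pow, ← ENNReal.rpow_two, ← ENNReal.rpow_two, ← ENNReal.rpow_mul, ← ENNReal.rpow_mul]
  norm_num

open scoped ENNReal in
/-- **Schur test** with a weight `w`. -/
lemma lintegral_sq_lintegral_mul_le {α : Type*} [MeasurableSpace α] {μ : Measure α} [SFinite μ]
    {k : α → α → ℝ≥0∞} (hk : Measurable (Function.uncurry k)) {w : α → ℝ≥0∞} (hw : Measurable w)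
    (hw0 : ∀ᵐ x ∂μ, w x ≠ 0) (hwt : ∀ᵐ x ∂μ, w x ≠ ∞) {C₁ C₂ : ℝ≥0∞}
    (h₁ : ∀ᵐ x ∂μ, ∫⁻ y, k x y * w y ∂μ ≤ C₁ * w x)
    (h₂ : ∀ᵐ y ∂μ, ∫⁻ x, k x y * w x ∂μ ≤ C₂ * w y)
    {f : α → ℝ≥0∞} (hf : Measurable f) :
    ∫⁻ x, (∫⁻ y, k x y * f y ∂μ) ^ 2 ∂μ ≤ C₁ * C₂ * ∫⁻ y, f y ^ 2 ∂μ := by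
  have hkx : ∀ x, Measurable (k x) := fun x => hk.comp measurable_prodMk_left
  have hky : ∀ y, Measurable fun x => k x y := fun x => hk.comp measurable_prodMk_right
  have hpt : ∀ᵐ x ∂μ, (∫⁻ y, k x y * f y ∂μ) ^ 2
      ≤ C₁ * ∫⁻ y, w x * (k x y * (f y ^ 2 * (w y)⁻¹)) ∂μ := by
    filter_upwards [h₁] with x hx
    -- Split k f as √(k w) · √(k f² / w): Cauchy–Schwarz then lets `h₁` absorb the first factor, and
    -- Tonelli with `h₂` treats the second.
    have hfac : ∫⁻ y, k x y * f y ∂μ = ∫⁻ y, (k x y * w y) ^ (1 / 2 : ℝ)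
        * (k x y * (f y ^ 2 * (w y)⁻¹)) ^ (1 / 2 : ℝ) ∂μ := by
      refine lintegral_congr_ae ?_
      filter_upwards [hw0, hwt] with y hy0 hyt
      rw [← ENNReal.mul_rpow_of_nonneg _ _ (by norm_num)]
      have : k x y * w y * (k x y * (f y ^ 2 * (w y)⁻¹)) = (k x y * f y) ^ (2 : ℝ) := by
        rw [ENNReal.rpow_two]
        calc _ = (k x y * f y) ^ 2 * (w y * (w y)⁻¹) := by ring
          _ = _ := by rw [ENNReal.mul_inv_cancel hy0 hyt, mul_one]
      rw [this, ← ENNReal.rpow_mul]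
      norm_num
    have hsq : ∀ z : ℝ≥0∞, (z ^ (1 / 2 : ℝ)) ^ 2 = z := fun z => by
      rw [← ENNReal.rpow_two, ← ENNReal.rpow_mul]
      norm_num
    rw [hfac]
    refine (lintegral_mul_sq_le ?_ ?_).trans ?_
    · exact (((hkx x).mul hw).pow_const _).aemeasurable
    · exact (((hkx x).mul ((hf.pow_const 2).mul hw.inv)).pow_const _).aemeasurable
    simp only [hsq]
    have hm : Measurable fun y => k x y * (f y ^ 2 * (w y)⁻¹) :=
      (hkx x).mul ((hf.pow_const 2).mul hw.inv)
    rw [lintegral_const_mul _ hm, ← mul_assoc]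
    gcongr
  refine (lintegral_mono_ae hpt).trans ?_
  have hm : Measurable (Function.uncurry fun x y => w x * (k x y * (f y ^ 2 * (w y)⁻¹))) :=
    (hw.comp measurable_fst).mul
      (hk.mul (((hf.pow_const 2).mul hw.inv).comp measurable_snd))
  rw [lintegral_const_mul _ hm.lintegral_prod_right, mul_assoc, lintegral_lintegral_swap
    hm.aemeasurable]
  gcongr
  rw [← lintegral_const_mul _ (hf.pow_const 2)]
  refine lintegral_mono_ae ?_
  filter_upwards [h₂, hw0, hwt] with y hy hy0 hyt
  calc ∫⁻ x, w x * (k x y * (f y ^ 2 * (w y)⁻¹)) ∂μ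
      = ∫⁻ x, (f y ^ 2 * (w y)⁻¹) * (k x y * w x) ∂μ := by
        refine lintegral_congr fun x => ?_
        ring
    _ = (f y ^ 2 * (w y)⁻¹) * ∫⁻ x, k x y * w x ∂μ :=
        lintegral_const_mul _ ((hky y).mul hw)
    _ ≤ (f y ^ 2 * (w y)⁻¹) * (C₂ * w y) := by gcongr
    _ = C₂ * f y ^ 2 * (w y * (w y)⁻¹) := by ring
    _ = C₂ * f y ^ 2 := by rw [ENNReal.mul_inv_cancel hy0 hyt, mul_one]

open scoped ENNReal NNReal in
/-- A measurable kernel that satisfies an `L²` bound in absolute value defines a bounded operator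
on `L²`. -/
lemma exists_integralOperator {α : Type*} [MeasurableSpace α] {μ : Measure α} [SFinite μ]
    {k : α → α → ℝ} (hk : Measurable (Function.uncurry k)) (C : ℝ≥0)
    (hC : ∀ f : α → ℝ≥0∞, Measurable f →
      ∫⁻ x, (∫⁻ y, ‖k x y‖ₑ * f y ∂μ) ^ 2 ∂μ ≤ C ^ 2 * ∫⁻ y, f y ^ 2 ∂μ) :
    ∃ A : Lp ℝ 2 μ →L[ℝ] Lp ℝ 2 μ, ∀ f : Lp ℝ 2 μ, A f =ᵐ[μ] fun x => ∫ y, k x y * f y ∂μ := by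
  have hkx : ∀ x, Measurable (k x) := fun x => hk.comp measurable_prodMk_left
  have hnorm : ∀ g : α → ℝ, eLpNorm g 2 μ = (∫⁻ y, ‖g y‖ₑ ^ 2 ∂μ) ^ (1 / 2 : ℝ) := by
    intro g
    rw [eLpNorm_eq_lintegral_rpow_enorm_toReal (by norm_num) (by norm_num)]
    simp
  have hfm : ∀ f : Lp ℝ 2 μ, Measurable fun y => ‖f y‖ₑ := fun f =>
    (Lp.stronglyMeasurable f).measurable.enorm
  have hbound : ∀ f : Lp ℝ 2 μ, (∫⁻ x, (∫⁻ y, ‖k x y‖ₑ * ‖f y‖ₑ ∂μ) ^ 2 ∂μ) ^ (1 / 2 : ℝ)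
      ≤ C * ‖f‖ₑ := by
    intro f
    rw [Lp.enorm_def, hnorm]
    refine (ENNReal.rpow_le_rpow (hC _ (hfm f)) (by norm_num)).trans_eq ?_
    rw [ENNReal.mul_rpow_of_nonneg _ _ (by norm_num), ← ENNReal.rpow_two, ← ENNReal.rpow_mul]
    norm_num
  have hint : ∀ f : Lp ℝ 2 μ, ∀ᵐ x ∂μ, Integrable (fun y => k x y * f y) μ := by
    intro f
    have hfin : ∫⁻ x, (∫⁻ y, ‖k x y‖ₑ * ‖f y‖ₑ ∂μ) ^ 2 ∂μ ≠ ∞ := by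
      intro h
      have := hbound f
      rw [h, ENNReal.top_rpow_of_pos (by norm_num)] at this
      exact (ENNReal.mul_lt_top ENNReal.coe_lt_top enorm_lt_top).not_ge this
    have hm : Measurable fun x => ∫⁻ y, ‖k x y‖ₑ * ‖f y‖ₑ ∂μ :=
      Measurable.lintegral_prod_right (hk.enorm.mul ((hfm f).comp measurable_snd))
    filter_upwards [ae_lt_top (hm.pow_const 2) hfin] with x hx
    refine ⟨((hkx x).mul (Lp.stronglyMeasurable f).measurable).aestronglyMeasurable, ?_⟩
    rw [hasFiniteIntegral_iff_enorm]
    simp only [enorm_mul]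
    by_contra h
    rw [not_lt_top_iff] at h
    simp [h] at hx
  have hle : ∀ f : Lp ℝ 2 μ, eLpNorm (fun x => ∫ y, k x y * f y ∂μ) 2 μ ≤ C * ‖f‖ₑ := by
    intro f
    refine le_trans ?_ (hbound f)
    rw [hnorm]
    gcongr with x
    refine (enorm_integral_le_lintegral_enorm _).trans_eq ?_
    simp only [enorm_mul]
  have hmem : ∀ f : Lp ℝ 2 μ, MemLp (fun x => ∫ y, k x y * f y ∂μ) 2 μ := fun f =>
    ⟨(StronglyMeasurable.integral_prod_right (hk.mul ((Lp.stronglyMeasurable f).measurable.comp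
      measurable_snd)).stronglyMeasurable).aestronglyMeasurable,
      (hle f).trans_lt (ENNReal.mul_lt_top ENNReal.coe_lt_top enorm_lt_top)⟩
  let A₀ : Lp ℝ 2 μ →ₗ[ℝ] Lp ℝ 2 μ :=
    { toFun := fun f => (hmem f).toLp _
      map_add' := by
        intro f g
        rw [← MemLp.toLp_add]
        refine MemLp.toLp_congr _ _ ?_
        filter_upwards [hint f, hint g] with x hf hg
        rw [Pi.add_apply, ← integral_add hf hg]
        refine integral_congr_ae ?_
        filter_upwards [Lp.coeFn_add f g] with y hy
        rw [hy, Pi.add_apply, mul_add]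
      map_smul' := by
        intro c f
        rw [RingHom.id_apply, ← MemLp.toLp_const_smul]
        refine MemLp.toLp_congr _ _ (ae_of_all _ fun x => ?_)
        rw [Pi.smul_apply, smul_eq_mul, ← integral_const_mul]
        refine integral_congr_ae ?_
        filter_upwards [Lp.coeFn_smul c f] with y hy
        rw [hy, Pi.smul_apply, smul_eq_mul, mul_left_comm] }
  refine ⟨A₀.mkContinuous C fun f => ?_, fun f => (hmem f).coeFn_toLp⟩
  have h := hle f
  rw [← Lp.enorm_toLp (hf := hmem f)] at h
  change ‖A₀ f‖ₑ ≤ C * ‖f‖ₑ at h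
  rw [← ofReal_norm, ← ofReal_norm, ← ENNReal.ofReal_coe_nnreal,
    ← ENNReal.ofReal_mul C.coe_nonneg] at h
  exact (ENNReal.ofReal_le_ofReal_iff (by positivity)).mp h

/-! ### The weighted fractional integration operator -/

lemma ae_pos_and_le (T : ℝ) : ∀ᵐ x ∂(volume.restrict (Set.Icc 0 T)), 0 < x ∧ x ≤ T := by
  rw [← restrict_Ioc_eq_restrict_Icc]
  exact (ae_restrict_iff' measurableSet_Ioc).mpr (ae_of_all _ fun x hx => hx)

/-- The weight u^{-α} cancels the factor u^α of the kernel. Integrating up to T + 1 instead of T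
keeps the interval nondegenerate when s = T. -/
lemma lintegral_fracKernel_mul_weight_le {α T s : ℝ} (hα : 0 < α) (hs : 0 < s) (hsT : s ≤ T) :
    ∫⁻ u in Set.Icc 0 T, ‖fracKernel α α s u‖ₑ * ENNReal.ofReal ((u ^ α)⁻¹)
      ≤ ENNReal.ofReal ((T + 1) ^ α / Real.Gamma (α + 1)) * ENNReal.ofReal ((s ^ α)⁻¹) := by
  have hG := Real.Gamma_pos_of_pos hα
  have hG1 := Real.Gamma_pos_of_pos (add_pos hα one_pos)
  have hT1 : s < T + 1 := by linarith
  have hpt : ∀ u, (Set.Icc 0 T).indicator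
        (fun u => ‖fracKernel α α s u‖ₑ * ENNReal.ofReal ((u ^ α)⁻¹)) u
      ≤ (Set.Ioo s (T + 1)).indicator (fun u => ENNReal.ofReal ((Real.Gamma α)⁻¹ * (s ^ α)⁻¹)
        * ENNReal.ofReal ((u - s) ^ (α - 1))) u := by
    intro u
    by_cases hu : u ∈ Set.Icc 0 T
    · rw [Set.indicator_of_mem hu]
      by_cases hsu : s < u
      · have hu0 : 0 < u := hs.trans hsu
        rw [Set.indicator_of_mem (show u ∈ Set.Ioo s (T + 1) from ⟨hsu, by linarith [hu.2]⟩),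
          Real.enorm_of_nonneg (fracKernel_nonneg hα _ _),
          ← ENNReal.ofReal_mul (fracKernel_nonneg hα _ _), ← ENNReal.ofReal_mul (by positivity),
          fracKernel_of_lt hs hsu]
        refine ENNReal.ofReal_le_ofReal (le_of_eq ?_)
        have : u ^ α ≠ 0 := (Real.rpow_pos_of_pos hu0 _).ne'
        field_simp
      · rw [fracKernel_of_le (not_lt.mp hsu)]
        simp
    · rw [Set.indicator_of_notMem hu]
      exact zero_le
  rw [← lintegral_indicator measurableSet_Icc]
  refine (lintegral_mono hpt).trans ?_
  rw [lintegral_indicator measurableSet_Ioo, lintegral_const_mul' _ _ ENNReal.ofReal_ne_top,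
    lintegral_sub_rpow hα hT1, ← ENNReal.ofReal_mul (by positivity),
    ← ENNReal.ofReal_mul (div_nonneg (Real.rpow_nonneg (by linarith) _) hG1.le)]
  refine ENNReal.ofReal_le_ofReal ?_
  have h1 : (T + 1 - s) ^ α ≤ (T + 1) ^ α :=
    Real.rpow_le_rpow (by linarith) (by linarith) hα.le
  calc (Real.Gamma α)⁻¹ * (s ^ α)⁻¹ * ((T + 1 - s) ^ α * (Real.Gamma α / Real.Gamma (α + 1)))
      = (T + 1 - s) ^ α / Real.Gamma (α + 1) * (s ^ α)⁻¹ := by field_simp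
    _ ≤ _ := by gcongr

/-- Here the singularity is s^{-2α}, integrable because α < 1/2. The Beta integral gives a constant,
and 1 ≤ T^α u^{-α} restores the weight. -/
lemma lintegral_fracKernel_mul_weight_left_le {α T u : ℝ} (hα : 0 < α) (hα2 : α < 1 / 2)
    (hu : 0 < u) (huT : u ≤ T) :
    ∫⁻ s in Set.Icc 0 T, ‖fracKernel α α s u‖ₑ * ENNReal.ofReal ((s ^ α)⁻¹)
      ≤ ENNReal.ofReal (T ^ α * (Real.Gamma (1 - 2 * α) / Real.Gamma (1 - α)))
        * ENNReal.ofReal ((u ^ α)⁻¹) := by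
  have hG := Real.Gamma_pos_of_pos hα
  have hG1 : 0 < Real.Gamma (1 - 2 * α) := Real.Gamma_pos_of_pos (by linarith)
  have hG2 : 0 < Real.Gamma (1 - α) := Real.Gamma_pos_of_pos (by linarith)
  have hT := hu.trans_le huT
  have hpt : ∀ s, ‖fracKernel α α s u‖ₑ * ENNReal.ofReal ((s ^ α)⁻¹)
      = (Set.Ioo 0 u).indicator (fun s => ENNReal.ofReal ((Real.Gamma α)⁻¹ * u ^ α)
        * ENNReal.ofReal ((s - 0) ^ (1 - 2 * α - 1) * (u - s) ^ (α - 1))) s := by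
    intro s
    by_cases hs : s ∈ Set.Ioo 0 u
    · have hs0 := hs.1
      rw [Set.indicator_of_mem hs, Real.enorm_of_nonneg (fracKernel_nonneg hα _ _),
        ← ENNReal.ofReal_mul (fracKernel_nonneg hα _ _), ← ENNReal.ofReal_mul (by positivity),
        fracKernel_of_lt hs.1 hs.2, sub_zero, show 1 - 2 * α - 1 = -α + -α by ring,
        Real.rpow_add hs.1, Real.rpow_neg hs.1.le]
      congr 1
      ring
    · rw [Set.indicator_of_notMem hs, fracKernel, if_neg (fun h => hs ⟨h.1, h.2⟩)]
      simp
  refine (setLIntegral_le_lintegral _ _).trans ?_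
  simp_rw [hpt]
  rw [lintegral_indicator measurableSet_Ioo, lintegral_const_mul' _ _ ENNReal.ofReal_ne_top,
    lintegral_sub_rpow_mul_sub_rpow (by linarith) hα hu, ← ENNReal.ofReal_mul (by positivity),
    ← ENNReal.ofReal_mul (by positivity)]
  refine ENNReal.ofReal_le_ofReal ?_
  rw [sub_zero, show 1 - 2 * α + α - 1 = -α by ring, show 1 - 2 * α + α = 1 - α by ring,
    Real.rpow_neg hu.le]
  have h1 : 1 ≤ T ^ α * (u ^ α)⁻¹ := by
    rw [← div_eq_mul_inv, one_le_div (by positivity)]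
    exact Real.rpow_le_rpow hu.le huT hα.le
  have h2 : 0 < u ^ α := by positivity
  calc (Real.Gamma α)⁻¹ * u ^ α * ((u ^ α)⁻¹ * (Real.Gamma (1 - 2 * α) * Real.Gamma α
        / Real.Gamma (1 - α)))
      = 1 * (Real.Gamma (1 - 2 * α) / Real.Gamma (1 - α)) := by field_simp
    _ ≤ (T ^ α * (u ^ α)⁻¹) * (Real.Gamma (1 - 2 * α) / Real.Gamma (1 - α)) := by gcongr
    _ = _ := by ring

theorem exists_fracOperator {α : ℝ} (hα : 0 < α) (hα2 : α < 1 / 2) (T : ℝ) :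
    ∃ R : Lp ℝ 2 (volume.restrict (Set.Icc 0 T)) →L[ℝ] Lp ℝ 2 (volume.restrict (Set.Icc 0 T)),
      ∀ f, R f =ᵐ[volume.restrict (Set.Icc 0 T)]
        fun s => ∫ u in Set.Icc 0 T, fracKernel α α s u * f u := by
  set c₁ := (T + 1) ^ α / Real.Gamma (α + 1)
  set c₂ := T ^ α * (Real.Gamma (1 - 2 * α) / Real.Gamma (1 - α))
  refine exists_integralOperator (measurable_fracKernel α α) (c₁.toNNReal + c₂.toNNReal) ?_
  intro f hf
  refine (lintegral_sq_lintegral_mul_le (k := fun s u => ‖fracKernel α α s u‖ₑ)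
    (measurable_fracKernel α α).enorm (w := fun u => ENNReal.ofReal ((u ^ α)⁻¹))
    (C₁ := ENNReal.ofReal c₁) (C₂ := ENNReal.ofReal c₂) (by fun_prop) ?_ (by simp) ?_ ?_ hf).trans
    ?_
  · filter_upwards [ae_pos_and_le T] with x hx
    have := hx.1
    rw [ENNReal.ofReal_ne_zero_iff]
    positivity
  · filter_upwards [ae_pos_and_le T] with s hs
    exact lintegral_fracKernel_mul_weight_le hα hs.1 hs.2
  · filter_upwards [ae_pos_and_le T] with u hu
    exact lintegral_fracKernel_mul_weight_left_le hα hα2 hu.1 hu.2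
  -- The sum c₁ + c₂ serves as operator bound since c₁ c₂ ≤ (c₁ + c₂)², which avoids a square root.
  · gcongr
    rw [sq, ENNReal.coe_add]
    exact mul_le_mul' (le_add_of_nonneg_right zero_le) (le_add_of_nonneg_left zero_le)

lemma integral_fracKernel_mul_ind {α t T : ℝ} (hα : 0 < α) (htT : t ≤ T) (s : ℝ) :
    ∫ u in Set.Icc 0 T, fracKernel α α s u * ind t u = fracPrim α α t s := by
  have hpt : ∀ u, (Set.Icc 0 T).indicator (fun u => fracKernel α α s u * ind t u) u
      = (Set.Iio t).indicator (fracKernel α α s) u := by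
    intro u
    by_cases hsu : 0 < s ∧ s < u
    · have hu0 := hsu.1.trans hsu.2
      by_cases hut : u < t
      · rw [Set.indicator_of_mem (show u ∈ Set.Icc 0 T from ⟨hu0.le, hut.le.trans htT⟩),
          Set.indicator_of_mem (show u ∈ Set.Iio t from hut), ind,
          Set.indicator_of_mem (show u ∈ Set.Ico 0 t from ⟨hu0.le, hut⟩), mul_one]
      · have h0 : ind t u = 0 := Set.indicator_of_notMem (fun h => hut h.2) _
        rw [Set.indicator_of_notMem (show u ∉ Set.Iio t from hut)]
        simp [Set.indicator, h0]
    · have : fracKernel α α s u = 0 := if_neg hsu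
      simp [Set.indicator, this]
  rw [← integral_indicator measurableSet_Icc]
  simp_rw [hpt]
  rw [integral_indicator measurableSet_Iio, integral_eq_lintegral_of_nonneg_ae
    (ae_of_all _ fun u => fracKernel_nonneg hα s u)
    (measurable_fracKernel_right α α s).aestronglyMeasurable, fracPrim]

/-- Tonelli and the semigroup law of the kernels. The cut-off at T is harmless since the fractional
integral of 𝟏_t vanishes beyond t ≤ T. -/
lemma integral_fracKernel_mul_fracPrim {α p t T : ℝ} (hα : 0 < α) (hp : 0 < p) (htT : t ≤ T)
    (s : ℝ) :
    ∫ u in Set.Icc 0 T, fracKernel α α s u * fracPrim α p t u = fracPrim α (α + p) t s := by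
  rw [integral_eq_lintegral_of_nonneg_ae
    (ae_of_all _ fun u => mul_nonneg (fracKernel_nonneg hα s u) (fracPrim_nonneg _ _ _ _))
    ((measurable_fracKernel_right α α s).mul (measurable_fracPrim α p t)).aestronglyMeasurable,
    fracPrim]
  congr 1
  have hpt : ∀ u, (Set.Icc 0 T).indicator
        (fun u => ENNReal.ofReal (fracKernel α α s u * fracPrim α p t u)) u
      = ∫⁻ v in Set.Iio t, ENNReal.ofReal (fracKernel α α s u)
        * ENNReal.ofReal (fracKernel α p u v) := by
    intro u
    rw [lintegral_const_mul' _ _ ENNReal.ofReal_ne_top, ← ofReal_fracPrim hα.le hp,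
      ← ENNReal.ofReal_mul (fracKernel_nonneg hα s u)]
    by_cases hu : u ∈ Set.Icc 0 T
    · rw [Set.indicator_of_mem hu]
    · rw [Set.indicator_of_notMem hu, fracPrim_eq_zero fun h => hu ⟨h.1.le, h.2.le.trans htT⟩]
      simp
  rw [← lintegral_indicator measurableSet_Icc]
  simp_rw [hpt]
  have hm : Measurable (Function.uncurry fun u v => ENNReal.ofReal (fracKernel α α s u)
        * ENNReal.ofReal (fracKernel α p u v)) :=
    ((measurable_fracKernel_right α α s).comp measurable_fst).ennreal_ofReal.mul
      (measurable_fracKernel α p).ennreal_ofReal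
  rw [lintegral_lintegral_swap hm.aemeasurable]
  simp_rw [lintegral_fracKernel_mul_fracKernel hα hp]

/-- The iterates of the operator with kernel `fracKernel α α` on `𝟏_t`. -/
lemma fracOperator_pow_indLp {α T t : ℝ} (hα : 0 < α) (htT : t ≤ T)
    {R : Lp ℝ 2 (volume.restrict (Set.Icc 0 T)) →L[ℝ] Lp ℝ 2 (volume.restrict (Set.Icc 0 T))}
    (hR : ∀ f, R f =ᵐ[volume.restrict (Set.Icc 0 T)]
        fun s => ∫ u in Set.Icc 0 T, fracKernel α α s u * f u) (n : ℕ) :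
    (R ^ (n + 1)) (indLp T t) =ᵐ[volume.restrict (Set.Icc 0 T)]
      fracPrim α ((n + 1 : ℕ) * α) t := by
  induction n with
  | zero =>
    rw [zero_add, pow_one, Nat.cast_one, one_mul]
    refine (hR _).trans (ae_of_all _ fun s => ?_)
    simp only []
    rw [← integral_fracKernel_mul_ind hα htT]
    refine integral_congr_ae ?_
    filter_upwards [(memLp_ind T t).coeFn_toLp] with u hu
    rw [indLp, hu]
  | succ n ih =>
    rw [pow_succ']
    refine (hR ((R ^ (n + 1)) (indLp T t))).trans (ae_of_all _ fun s => ?_)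
    have h : ((n + 1 + 1 : ℕ) : ℝ) * α = α + ((n + 1 : ℕ) : ℝ) * α := by
      push_cast
      ring
    simp only []
    rw [h, ← integral_fracKernel_mul_fracPrim hα (by positivity) htT]
    refine integral_congr_ae ?_
    filter_upwards [ih] with u hu
    rw [hu]

/-! ### The inverse kernel -/

lemma kernelLinvTerm_eq {a b H : ℝ} (hH : 1 / 2 < H) (t : ℝ) {s : ℝ} (hs : 0 ≤ s) (n : ℕ) :
    kernelLinvTerm a b H t s n
      = (-(b / a * (mgConst H * Real.Gamma (H - 1 / 2)))) ^ (n + 1)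
        * fracPrim (H - 1 / 2) ((n + 1 : ℕ) * (H - 1 / 2)) t s := by
  rw [kernelLinvTerm, gammaKernel_eq hH (Nat.add_one_ne_zero n) t hs, neg_pow (b / a * _), mul_pow (b / a)]
  ring

/-- The bound separates into a Mittag-Leffler term and the fixed function s^{-α}, so it yields both
pointwise and L² summability. -/
lemma abs_pow_mul_fracPrim_le {α t s : ℝ} (hα : 0 < α) (ht : 0 ≤ t) (hs : 0 ≤ s) (ρ : ℝ) (n : ℕ) :
    |ρ ^ (n + 1) * fracPrim α ((n + 1 : ℕ) * α) t s|
      ≤ t ^ α * ((|ρ| * t ^ α) ^ (n + 1) / Real.Gamma ((n + 1 : ℕ) * α + 1)) * (s ^ α)⁻¹ := by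
  have h := fracPrim_le hα.le (p := (n + 1 : ℕ) * α) (by positivity) ht hs
  have hpow : t ^ (((n + 1 : ℕ) : ℝ) * α) = (t ^ α) ^ (n + 1) := by
    rw [mul_comm, Real.rpow_mul ht, Real.rpow_natCast]
  rw [abs_mul, abs_pow, abs_of_nonneg (fracPrim_nonneg _ _ _ _)]
  refine (mul_le_mul_of_nonneg_left h (by positivity)).trans_eq ?_
  rw [hpow, mul_pow]
  ring

lemma summable_kernel_bound {α : ℝ} (hα : 0 < α) (t ρ : ℝ) :
    Summable fun n : ℕ =>
      t ^ α * ((|ρ| * t ^ α) ^ (n + 1) / Real.Gamma ((n + 1 : ℕ) * α + 1)) :=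
  ((summable_nat_add_iff 1).mpr (summable_pow_div_Gamma hα (|ρ| * t ^ α))).mul_left _

lemma summable_kernelLinvTerm {H : ℝ} (hH : 1 / 2 < H) (a b : ℝ) {t s : ℝ} (ht : 0 ≤ t)
    (hs : 0 ≤ s) : Summable (kernelLinvTerm a b H t s) := by
  refine Summable.of_norm_bounded
    ((summable_kernel_bound (sub_pos.mpr hH) t
      (-(b / a * (mgConst H * Real.Gamma (H - 1 / 2))))).mul_right ((s ^ (H - 1 / 2))⁻¹))
    fun n => ?_
  rw [kernelLinvTerm_eq hH t hs, Real.norm_eq_abs]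
  exact abs_pow_mul_fracPrim_le (sub_pos.mpr hH) ht hs _ n

/-- L²-convergence gives almost sure convergence of the partial sums along a subsequence, which
identifies the L² sum with the pointwise one. -/
lemma coeFn_tsum {α : Type*} [MeasurableSpace α] {μ : Measure α} {y : ℕ → Lp ℝ 2 μ}
    (hy : Summable y) {g : ℕ → α → ℝ} (hg : ∀ n, y n =ᵐ[μ] g n)
    (hs : ∀ᵐ x ∂μ, Summable fun n => g n x) :
    (∑' n, y n : Lp ℝ 2 μ) =ᵐ[μ] fun x => ∑' n, g n x := by
  obtain ⟨ns, hns, hlim⟩ :=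
    (tendstoInMeasure_of_tendsto_Lp hy.hasSum.tendsto_sum_nat).exists_seq_tendsto_ae
  have hpart : ∀ᵐ x ∂μ, ∀ n, (∑ i ∈ Finset.range n, y i : Lp ℝ 2 μ) x
      = ∑ i ∈ Finset.range n, g i x := by
    refine ae_all_iff.mpr fun n => ?_
    induction n with
    | zero => simpa using! Lp.coeFn_zero ℝ 2 μ
    | succ n ih =>
      rw [Finset.sum_range_succ]
      filter_upwards [ih, hg n, Lp.coeFn_add (∑ i ∈ Finset.range n, y i) (y n)] with x h1 h2 h3
      rw [h3, Pi.add_apply, h1, h2, Finset.sum_range_succ]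
  filter_upwards [hlim, hpart, hs] with x h1 h2 h3
  refine tendsto_nhds_unique h1 ?_
  simp only [h2]
  exact h3.hasSum.tendsto_sum_nat.comp hns.tendsto_atTop

lemma memLp_inv_rpow {α T : ℝ} (hα2 : α < 1 / 2) :
    MemLp (fun s : ℝ => (s ^ α)⁻¹) 2 (volume.restrict (Set.Icc 0 T)) := by
  rw [memLp_two_iff_integrable_sq (by fun_prop)]
  rcases le_or_gt T 0 with hT | hT
  · have : volume.restrict (Set.Icc 0 T) = 0 := by
      rw [Measure.restrict_eq_zero, Real.volume_Icc]
      simpa using hT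
    rw [this]
    exact integrable_zero_measure
  have h := intervalIntegral.intervalIntegrable_rpow' (a := 0) (b := T) (r := -(2 * α))
    (by linarith)
  rw [intervalIntegrable_iff_integrableOn_Icc_of_le hT.le] at h
  refine h.congr ?_
  filter_upwards [ae_pos_and_le T] with s hs
  rw [Real.rpow_neg hs.1.le, inv_pow, mul_comm, Real.rpow_mul hs.1.le, Real.rpow_two]

lemma summable_smul_fracOperator_pow {α T t : ℝ} (hα : 0 < α) (hα2 : α < 1 / 2)
    (ht : t ∈ Set.Icc 0 T)
    {R : Lp ℝ 2 (volume.restrict (Set.Icc 0 T)) →L[ℝ] Lp ℝ 2 (volume.restrict (Set.Icc 0 T))}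
    (hR : ∀ f, R f =ᵐ[volume.restrict (Set.Icc 0 T)]
        fun s => ∫ u in Set.Icc 0 T, fracKernel α α s u * f u) (ρ : ℝ) :
    Summable fun n : ℕ => ρ ^ (n + 1) • (R ^ (n + 1)) (indLp T t) := by
  set w := (memLp_inv_rpow (T := T) hα2).toLp
  refine Summable.of_norm_bounded ((summable_kernel_bound hα t ρ).mul_right ‖w‖) fun n => ?_
  refine Lp.norm_le_mul_norm_of_ae_le_mul ?_
  filter_upwards [Lp.coeFn_smul (ρ ^ (n + 1)) ((R ^ (n + 1)) (indLp T t)),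
    fracOperator_pow_indLp hα ht.2 hR n, (memLp_inv_rpow (T := T) hα2).coeFn_toLp,
    ae_pos_and_le T] with s h1 h2 h3 h4
  rw [h1, Pi.smul_apply, h2, h3, smul_eq_mul, Real.norm_eq_abs,
    Real.norm_of_nonneg (inv_nonneg.mpr (Real.rpow_nonneg h4.1.le _))]
  exact abs_pow_mul_fracPrim_le hα ht.1 h4.1.le ρ n

/-- The Neumann series solves the Volterra equation. -/
lemma map_neumann_series {E : Type*} [NormedAddCommGroup E] [NormedSpace ℝ E]
    (R : E →L[ℝ] E) (x : E) (ρ : ℝ) (h : Summable fun n : ℕ => ρ ^ (n + 1) • (R ^ (n + 1)) x) :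
    (x + ∑' n : ℕ, ρ ^ (n + 1) • (R ^ (n + 1)) x)
      - ρ • R (x + ∑' n : ℕ, ρ ^ (n + 1) • (R ^ (n + 1)) x) = x := by
  -- Only the orbit of the single vector x has to be summable, not the operator series.
  have h0 : Summable fun n : ℕ => ρ ^ n • (R ^ n) x :=
    (summable_nat_add_iff (f := fun n : ℕ => ρ ^ n • (R ^ n) x) 1).mp h
  have h1 : x + ∑' n : ℕ, ρ ^ (n + 1) • (R ^ (n + 1)) x = ∑' n : ℕ, ρ ^ n • (R ^ n) x := by
    rw [h0.tsum_eq_zero_add]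
    simp
  have h2 : ρ • R (∑' n : ℕ, ρ ^ n • (R ^ n) x) = ∑' n : ℕ, ρ ^ (n + 1) • (R ^ (n + 1)) x := by
    rw [R.map_tsum h0, ← (h0.mapL R).tsum_const_smul]
    refine tsum_congr fun n => ?_
    rw [map_smul, smul_smul, ← pow_succ', pow_succ' R]
    rfl
  rw [h1, h2, ← h1, add_sub_cancel_right]

/-- In `L²([0,T])` the function `L⁻¹(t,·)` is mapped to `𝟏_t` by the operator `𝟏_t ↦ L(t,·)`. -/
lemma exists_operatorL {T a b H : ℝ} (ha : a ≠ 0) (hH : H ∈ Set.Ioo (1 / 2 : ℝ) 1) :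
    ∃ D : Lp ℝ 2 (volume.restrict (Set.Icc 0 T)) →L[ℝ] Lp ℝ 2 (volume.restrict (Set.Icc 0 T)),
      (∀ t ∈ Set.Icc 0 T,
        ∃ k : Lp ℝ 2 (volume.restrict (Set.Icc 0 T)),
          k =ᵐ[volume.restrict (Set.Icc 0 T)] (Set.Ico 0 t).indicator (fun s => mgKernel H t s) ∧
          D (indLp T t) = a • indLp T t + b • k) ∧
      ∀ t ∈ Set.Icc 0 T, ∃ v : Lp ℝ 2 (volume.restrict (Set.Icc 0 T)),
        v =ᵐ[volume.restrict (Set.Icc 0 T)]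
          (Set.Ico 0 t).indicator (fun s => kernelLinv a b H t s) ∧
        D v = indLp T t := by
  have hα : 0 < H - 1 / 2 := sub_pos.mpr hH.1
  have hα2 : H - 1 / 2 < 1 / 2 := by linarith [hH.2]
  obtain ⟨R, hR⟩ := exists_fracOperator hα hα2 T
  set κ := mgConst H * Real.Gamma (H - 1 / 2) with hκ
  set ρ := -(b / a * κ) with hρ
  -- D = a + bκR = a (1 - ρR), so a⁻¹ times the Neumann series in ρR is the preimage of 𝟏_t.
  refine ⟨a • ContinuousLinearMap.id ℝ _ + (b * κ) • R, fun t ht => ?_, fun t ht => ?_⟩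
  · refine ⟨κ • R (indLp T t), ?_, ?_⟩
    · have h := fracOperator_pow_indLp hα ht.2 hR 0
      rw [zero_add, pow_one, Nat.cast_one, one_mul] at h
      filter_upwards [Lp.coeFn_smul κ (R (indLp T t)), h, ae_pos_and_le T] with s h1 h2 h3
      rw [h1, Pi.smul_apply, h2, smul_eq_mul]
      by_cases hst : s < t
      · rw [Set.indicator_of_mem (show s ∈ Set.Ico 0 t from ⟨h3.1.le, hst⟩),
          mgKernel_eq hH.1 t h3.1.le]
      · rw [Set.indicator_of_notMem (fun h => hst h.2), fracPrim_eq_zero (fun h => hst h.2),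
          mul_zero]
    · simp [mul_smul]
  · have hsum := summable_smul_fracOperator_pow hα hα2 ht hR ρ
    refine ⟨a⁻¹ • (indLp T t + ∑' n : ℕ, ρ ^ (n + 1) • (R ^ (n + 1)) (indLp T t)), ?_, ?_⟩
    · have hterm : ∀ n : ℕ, (ρ ^ (n + 1) • (R ^ (n + 1)) (indLp T t) : Lp ℝ 2 _)
          =ᵐ[volume.restrict (Set.Icc 0 T)] fun s => kernelLinvTerm a b H t s n := by
        intro n
        filter_upwards [Lp.coeFn_smul (ρ ^ (n + 1)) ((R ^ (n + 1)) (indLp T t)),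
          fracOperator_pow_indLp hα ht.2 hR n, ae_pos_and_le T] with s h1 h2 h3
        rw [h1, Pi.smul_apply, h2, smul_eq_mul, kernelLinvTerm_eq hH.1 t h3.1.le]
      have hS := coeFn_tsum hsum hterm (by
        filter_upwards [ae_pos_and_le T] with s hs
        exact summable_kernelLinvTerm hH.1 a b ht.1 hs.1.le)
      set S := ∑' n : ℕ, ρ ^ (n + 1) • (R ^ (n + 1)) (indLp T t)
      filter_upwards [Lp.coeFn_smul a⁻¹ (indLp T t + S), Lp.coeFn_add (indLp T t) S, hS,
        (memLp_ind T t).coeFn_toLp, ae_pos_and_le T] with s h1 h2 h3 h4 h5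
      rw [h1, Pi.smul_apply, h2, Pi.add_apply, h3, indLp, h4, smul_eq_mul]
      by_cases hst : s < t
      · rw [Set.indicator_of_mem (show s ∈ Set.Ico 0 t from ⟨h5.1.le, hst⟩), kernelLinv]
        ring
      · rw [Set.indicator_of_notMem (fun h => hst h.2), ind,
          Set.indicator_of_notMem (fun h => hst h.2)]
        simp [kernelLinvTerm, gammaKernel, hst]
    · have h := map_neumann_series R (indLp T t) ρ hsum
      set v := indLp T t + ∑' n : ℕ, ρ ^ (n + 1) • (R ^ (n + 1)) (indLp T t)
      have hb : b * κ * a⁻¹ = -ρ := by rw [hρ]; field_simp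
      rw [add_apply, smul_apply, smul_apply, ContinuousLinearMap.id_apply, map_smul, smul_smul,
        smul_smul, mul_inv_cancel₀ ha, one_smul, hb, neg_smul, ← sub_eq_add_neg, h]

lemma IsPreBrownianOn.congr {P : Measure Ω} {T : ℝ} {B W : ℝ → Ω → ℝ} (hB : IsPreBrownianOn P T B)
    (h : ∀ t ∈ Set.Icc 0 T, W t =ᵐ[P] B t) : IsPreBrownianOn P T W where
  gaussian := hB.gaussian.congr fun t => (h t t.2).symm
  mean t ht := (integral_congr_ae (h t ht)).trans (hB.mean t ht)
  covariance t ht s hs := by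
    rw [← hB.covariance t ht s hs, ProbabilityTheory.covariance,
      ProbabilityTheory.covariance, integral_congr_ae (h t ht),
      integral_congr_ae (h s hs)]
    refine integral_congr_ae ?_
    filter_upwards [h t ht, h s hs] with ω h1 h2
    rw [h1, h2]

end CCMFBM

/-! ### Proof of the theorem. -/

open CCMFBM in
theorem mainTheorem1 {Ω : Type*} [MeasurableSpace Ω] (P : Measure Ω) [IsProbabilityMeasure P]
    (T a b H : ℝ) (hT : 0 < T) (hab : a * b ≠ 0) (hH : H ∈ Set.Ioo (1 / 2 : ℝ) 1)
    (B X : ℝ → Ω → ℝ) (hX : CCMFBM.IsCCMFBM P T a b H B X) :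
    -- the series that defines `L⁻¹(t,s)` converges
    (∀ t ∈ Set.Icc 0 T, ∀ s ∈ Set.Icc 0 T, Summable (CCMFBM.kernelLinvTerm a b H t s)) ∧
    -- the abstract Wiener integrals `∫_0^t L⁻¹(t,s) dX_s` exist
    (∀ t ∈ Set.Icc 0 T, ∃ Y : Ω → ℝ,
      CCMFBM.IsWienerIntegralUpTo P T X t (fun s => CCMFBM.kernelLinv a b H t s) Y) ∧
    -- the process `W` that they define
    ∀ W : ℝ → Ω → ℝ,
      (∀ t ∈ Set.Icc 0 T,
        CCMFBM.IsWienerIntegralUpTo P T X t (fun s => CCMFBM.kernelLinv a b H t s) (W t)) →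
      -- is a Brownian motion (after a modification, as each `W_t` is defined up to a null set),
      CCMFBM.IsPreBrownianOn P T W ∧
      (∃ V : ℝ → Ω → ℝ, CCMFBM.IsBrownianOn P T V ∧ ∀ t ∈ Set.Icc 0 T, V t =ᵐ[P] W t) ∧
      -- it reconstructs `X`,
      (∀ t ∈ Set.Icc 0 T,
        CCMFBM.IsWienerIntegralUpTo P T W t (fun s => CCMFBM.kernelL a b H t s) (X t)) ∧
      -- and it is the Brownian motion that drives `X`
      (∀ t ∈ Set.Icc 0 T, W t =ᵐ[P] B t) := by
  obtain ⟨I, hI⟩ := exists_wienerIsometry hT hX.brownian.toIsPreBrownianOn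
  obtain ⟨D, hD, hDinv⟩ := exists_operatorL (T := T) (b := b) (left_ne_zero_of_mul hab) hH
  obtain ⟨BH, hBH, hXB⟩ := hX.eq_mix
  have hIX : ∀ t ∈ Set.Icc 0 T, I (D (indLp T t)) =ᵐ[P] X t := by
    intro t ht
    obtain ⟨k, hk, hDk⟩ := hD t ht
    rw [hDk, map_add, map_smul, map_smul]
    filter_upwards [Lp.coeFn_add (a • I (indLp T t)) (b • I k), Lp.coeFn_smul a (I (indLp T t)),
      Lp.coeFn_smul b (I k), hI t ht, (isWienerIntegral_iff hT I hI k hk _).mp (hBH t ht),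
      hXB t ht] with ω h1 h2 h3 h4 h5 h6
    rw [h1, Pi.add_apply, h2, h3, Pi.smul_apply, Pi.smul_apply, h4, h5, h6, smul_eq_mul,
      smul_eq_mul]
  -- Integration against X is I ∘ D, and D sends L⁻¹(t,·) to 𝟏_t, so the integral can only be B_t.
  have hiff : ∀ t ∈ Set.Icc 0 T, ∀ Y : Ω → ℝ,
      IsWienerIntegralUpTo P T X t (fun s => kernelLinv a b H t s) Y ↔ B t =ᵐ[P] Y := by
    intro t ht Y
    obtain ⟨v, hv, hDv⟩ := hDinv t ht
    rw [IsWienerIntegralUpTo, isWienerIntegral_iff hT (I.comp D) hIX v hv,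
      ContinuousLinearMap.comp_apply, hDv]
    exact ⟨fun h => (hI t ht).symm.trans h, fun h => (hI t ht).trans h⟩
  refine ⟨fun t ht s hs => summable_kernelLinvTerm hH.1 a b ht.1 hs.1,
    fun t ht => ⟨B t, (hiff t ht _).mpr (ae_eq_refl _)⟩, fun W hW => ?_⟩
  have hWB : ∀ t ∈ Set.Icc 0 T, W t =ᵐ[P] B t := fun t ht => ((hiff t ht _).mp (hW t ht)).symm
  refine ⟨hX.brownian.toIsPreBrownianOn.congr hWB,
    ⟨B, hX.brownian, fun t ht => (hWB t ht).symm⟩, fun t ht => ?_, hWB⟩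
  obtain ⟨k, hk, hDk⟩ := hD t ht
  -- Since W_t = B_t almost surely, I is also the Wiener isometry of W.
  refine (isWienerIntegral_iff hT I (fun s hs => (hI s hs).trans (hWB s hs).symm)
    (D (indLp T t)) ?_ _).mpr (hIX t ht)
  rw [hDk]
  filter_upwards [Lp.coeFn_add (a • indLp T t) (b • k), Lp.coeFn_smul a (indLp T t),
    Lp.coeFn_smul b k, (memLp_ind T t).coeFn_toLp, hk] with s h1 h2 h3 h4 h5
  rw [h1, Pi.add_apply, h2, h3, Pi.smul_apply, Pi.smul_apply, indLp, h4, h5]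
  by_cases hs : s ∈ Set.Ico 0 t <;> simp [kernelL, ind, hs]

end
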